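/- Let $d\ge 1$ be an integer. A state is a positive semidefinite complex $d\times d$ matrix of trace one; $\|A\|_1=\operatorname{tr}\sqrt{A^\dagger A}$; $\log$ is the natural logarithm; and $D(\rho\|\sigma)=\operatorname{tr}\rho(\log\rho-\log\sigma)$ if $\ker\sigma\subseteq\ker\rho$, $D(\rho\|\sigma)=\infty$ otherwise. A measurement is a family $M=(M_i)_{i\in\mathcal I}$ of positive semidefinite $d\times d$ matrices with finite outcome set $\mathcal I$ and $\sum_i M_i=\mathbb 1$; its measuring channel is $\Phi_M(\rho)=\sum_i\operatorname{tr}(\rho M_i)\,|i\rangle\langle i|$. The disjoint convex combination of measurements $M_1,\dots,M_m$ with weights $\lambda_k\ge0$, $\sum_k\lambda_k=1$, is the measurement on the disjoint union of the outcome sets with elements $(\lambda_k (M_k)_i)_{(k,i)}$. **Theorem.** Let $\chi$ be a nonempty compact convex set of states, and let $\mathscr M$ be a set of measurements that is convex (for each fixed outcome set, closed under elementwise convex combinations) and closed under finite disjoint convex combinations. For states $\rho$ define, with values in $[0,\infty]$, $$Z(\rho)=\inf_{\sigma\in\chi}\ \sup_{M\in\mathscr M} D(\Phi_M(\rho)\|\Phi_M(\sigma)),\qquad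 Z_M(\rho)=\inf_{\sigma\in\chi} D(\Phi_M(\rho)\|\Phi_M(\sigma)),$$ $$\kappa=\sup_{M\in\mathscr M}\ \sup_{\mu,\nu}\ |Z_M(\mu)-Z_M(\nu)|,$$ where $\mu,\nu$ range over all states. Let $g(x)=-x\log x+(1+x)\log(1+x)$ for $x>0$ and $g(0)=0$. Then for all states $\rho,\rho'$ and every real $\varepsilon$ with $\tfrac12\|\rho-\rho'\|_1\le\varepsilon$, $$|Z(\rho)-Z(\rho')|\le g(\varepsilon)+\varepsilon\,\kappa ,$$ and $Z(\rho)$ and $Z(\rho')$ are finite whenever $\kappa<\infty$. (Conventions: $\sup\emptyset=0$, $|\infty-\infty|=0$, $0\cdot\infty=0$.) -/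

import Mathlib

open scoped ENNReal Matrix ComplexOrder

universe u v

/-- Quantum states on the Hilbert space `ℂ^d`: positive semidefinite matrices of unit trace. -/
def IsQuantumState {d : Type v} [Fintype d] (ρ : Matrix d d ℂ) : Prop :=
  ρ.PosSemidef ∧ ρ.trace = 1

/-- The trace norm `‖A‖₁ = tr √(A† A)`; the square root is taken by functional calculus. -/
noncomputable def traceNorm {d : Type v} [Fintype d] [DecidableEq d] (A : Matrix d d ℂ) : ℝ :=
  (Matrix.trace (cfc Real.sqrt (Aᴴ * A))).re

/-- The quantum relative entropy `D(ρ‖σ)` of two states (natural logarithm): it is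
`tr ρ (log ρ - log σ)` if `ker σ ⊆ ker ρ`, and `∞` otherwise. The matrix logarithm is taken by
functional calculus with `log 0 = 0`, that is, on the support. For two states the trace is a
nonnegative real number, so nothing is lost in taking values in `[0, ∞]`. -/
noncomputable def quantumRelEntropy {n : Type u} [Fintype n] [DecidableEq n]
    (ρ σ : Matrix n n ℂ) : ℝ≥0∞ :=
  open Classical in
  if ∀ x : n → ℂ, σ *ᵥ x = 0 → ρ *ᵥ x = 0 then
    ENNReal.ofReal (Matrix.trace (ρ * (cfc Real.log ρ - cfc Real.log σ))).re
  else ⊤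

/-- A measurement on `ℂ^d`: a POVM with a finite set of outcomes. -/
structure Measurement (d : Type v) [Fintype d] [DecidableEq d] : Type (max (u + 1) v) where
  /-- the outcome set -/
  Outcome : Type u
  [fintypeOutcome : Fintype Outcome]
  /-- the POVM elements -/
  effect : Outcome → Matrix d d ℂ
  posSemidef : ∀ i, (effect i).PosSemidef
  sum_eq_one : ∑ i, effect i = 1

attribute [instance] Measurement.fintypeOutcome

/-- The measuring channel `Φ_M(ρ) = ∑ i, tr(ρ M_i) |i⟩⟨i|`. -/
noncomputable def Measurement.channel {d : Type v} [Fintype d] [DecidableEq d]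
    (M : Measurement.{u, v} d) (ρ : Matrix d d ℂ) : Matrix M.Outcome M.Outcome ℂ :=
  open Classical in
  ∑ i, (ρ * M.effect i).trace • Matrix.single i i 1

/-- The measured relative entropy `D(Φ_M(ρ)‖Φ_M(σ))` of a single measurement. -/
noncomputable def Measurement.relEntropy {d : Type v} [Fintype d] [DecidableEq d]
    (M : Measurement.{u, v} d) (ρ σ : Matrix d d ℂ) : ℝ≥0∞ :=
  open Classical in
  quantumRelEntropy (M.channel ρ) (M.channel σ)

/-- The disjoint convex combination `⊕_k w_k M_k`: the outcome set is the disjoint union of the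
outcome sets, and the POVM element of the outcome `(k, i)` is `w_k (M_k)_i`. -/
noncomputable def Measurement.disjointMix {d : Type v} [Fintype d] [DecidableEq d] {m : ℕ}
    (w : Fin m → ℝ) (hw : ∀ k, 0 ≤ w k) (hw1 : ∑ k, w k = 1)
    (M : Fin m → Measurement.{u, v} d) : Measurement.{u, v} d where
  Outcome := Σ k, (M k).Outcome
  effect x := w x.1 • (M x.1).effect x.2
  posSemidef x := ((M x.1).posSemidef x.2).smul (hw x.1)
  sum_eq_one := by
    rw [Fintype.sum_sigma]
    simp only [← Finset.smul_sum, Measurement.sum_eq_one]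
    rw [← Finset.sum_smul, hw1, one_smul]

/-- A set of measurements is convex if, for every outcome set, the measurements of the set with
these outcomes form a convex set under elementwise convex combination of POVM elements. -/
def MeasurementsConvex {d : Type v} [Fintype d] [DecidableEq d]
    (𝓜 : Set (Measurement.{u, v} d)) : Prop :=
  ∀ (ι : Type u) [Fintype ι],
    Convex ℝ {E : ι → Matrix d d ℂ |
      ∃ (h : ∀ i, (E i).PosSemidef) (h1 : ∑ i, E i = 1),
        ({ Outcome := ι, effect := E, posSemidef := h, sum_eq_one := h1 } :
          Measurement.{u, v} d) ∈ 𝓜}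

/-- A set of measurements is closed under finite disjoint convex combinations. -/
def ClosedUnderDisjointMix {d : Type v} [Fintype d] [DecidableEq d]
    (𝓜 : Set (Measurement.{u, v} d)) : Prop :=
  ∀ (m : ℕ) (w : Fin m → ℝ) (hw : ∀ k, 0 ≤ w k) (hw1 : ∑ k, w k = 1)
    (M : Fin m → Measurement.{u, v} d), (∀ k, M k ∈ 𝓜) →
      Measurement.disjointMix w hw hw1 M ∈ 𝓜

/-- `Z(ρ) = inf_{σ ∈ χ} sup_{M ∈ 𝓜} D(Φ_M(ρ)‖Φ_M(σ))`, with values in `[0, ∞]`. -/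
noncomputable def measuredDistance {d : Type v} [Fintype d] [DecidableEq d]
    (χ : Set (Matrix d d ℂ)) (𝓜 : Set (Measurement.{u, v} d)) (ρ : Matrix d d ℂ) : ℝ≥0∞ :=
  ⨅ σ ∈ χ, ⨆ M ∈ 𝓜, M.relEntropy ρ σ

/-- `Z_M(ρ) = inf_{σ ∈ χ} D(Φ_M(ρ)‖Φ_M(σ))`, with values in `[0, ∞]`. -/
noncomputable def singleMeasuredDistance {d : Type v} [Fintype d] [DecidableEq d]
    (χ : Set (Matrix d d ℂ)) (M : Measurement.{u, v} d) (ρ : Matrix d d ℂ) : ℝ≥0∞ :=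
  ⨅ σ ∈ χ, M.relEntropy ρ σ

/-- The absolute difference `|a - b|` in `[0, ∞]` (equal to `∞` if exactly one of the two is
infinite, and to `0` if both are). -/
noncomputable def absDifference (a b : ℝ≥0∞) : ℝ≥0∞ := max (a - b) (b - a)

/-- The maximum variation `κ = sup_{M ∈ 𝓜} sup_{μ, ν} |Z_M(μ) - Z_M(ν)|`, over all states
`μ` and `ν`. -/
noncomputable def maximumVariation {d : Type v} [Fintype d] [DecidableEq d]
    (χ : Set (Matrix d d ℂ)) (𝓜 : Set (Measurement.{u, v} d)) : ℝ≥0∞ :=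
  ⨆ M ∈ 𝓜, ⨆ (μ : Matrix d d ℂ) (ν : Matrix d d ℂ) (_ : IsQuantumState μ) (_ : IsQuantumState ν),
    absDifference (singleMeasuredDistance χ M μ) (singleMeasuredDistance χ M ν)

/-- `g(x) = -x log x + (1 + x) log (1 + x)`, with `g(0) = 0`. -/
noncomputable def gFun (x : ℝ) : ℝ := -x * Real.log x + (1 + x) * Real.log (1 + x)

/-! The core is an Alicki–Fannes–Winter argument for each single measurement $M$. The function $Z_M$
is convex, because relative entropy is jointly convex and $\chi$ is convex. It is also concave up to
the entropy $-a\log a-b\log b$ of the mixing weights. If $\rho,\rho'$ have trace distance at most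
$\varepsilon>0$, there are states with $\rho+\varepsilon\mu=\rho'+\varepsilon\nu$. Dividing by
$1+\varepsilon$ gives one state with two decompositions. Almost concavity along the first and
convexity along the second give $Z_M(\rho)+\varepsilon Z_M(\mu)\le Z_M(\rho')+\varepsilon
Z_M(\nu)+g(\varepsilon)$, where $Z_M(\nu)-Z_M(\mu)\le\kappa$ (`singleMeasuredDistance_le_add`).

The bound is uniform in $M$, so it survives a supremum. It remains to see that $Z=\sup_M Z_M$
(`measuredDistance_eq_iSup`). This is a minimax exchange: the divergence is convex and lower
semicontinuous in $\sigma$ on the compact set $\chi$, and a disjoint mixture realises exactly the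
weighted sum of divergences. Finiteness follows since $Z_M$ vanishes on $\chi$, whence
$Z_M\le\kappa$.

The classical divergence is a sum of terms `klTerm`. Its variational form yields convexity,
homogeneity, lower semicontinuity and the conventions at zero together. -/

/-! ### Scalar relative entropy -/

/-- The summand `p log (p / q) + q - p` of the classical relative entropy, with values in `[0, ∞]`,
as a supremum of functions linear in `(p, q)`. -/
noncomputable def klTerm (p q : ℝ) : ℝ≥0∞ :=
  ⨆ s : ℝ, ENNReal.ofReal (p * s + q * (1 - Real.exp s))

/-- The supremum is attained at $s=\log(p/q)$ if $p>0$; for $p=0$ it is only approached as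
$s\to-\infty$. -/
theorem klTerm_of_pos {p q : ℝ} (hp : 0 ≤ p) (hq : 0 < q) :
    klTerm p q = ENNReal.ofReal (p * (Real.log p - Real.log q) + q - p) := by
  apply le_antisymm
  · refine iSup_le fun s => ENNReal.ofReal_le_ofReal ?_
    rcases hp.eq_or_lt with rfl | hp
    · nlinarith [mul_pos hq (Real.exp_pos s)]
    · have h := Real.add_one_le_exp (s - (Real.log p - Real.log q))
      rw [Real.exp_sub, Real.exp_sub, Real.exp_log hp, Real.exp_log hq] at h
      have h2 := mul_le_mul_of_nonneg_left h hp.le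
      have h3 : p * (Real.exp s / (p / q)) = q * Real.exp s := by field_simp
      rw [h3] at h2
      linarith
  · rcases hp.eq_or_lt with rfl | hp
    · have hlim : Filter.Tendsto (fun s : ℝ => ENNReal.ofReal (0 * s + q * (1 - Real.exp s)))
          Filter.atBot (nhds (ENNReal.ofReal (0 * (Real.log 0 - Real.log q) + q - 0))) := by
        refine (ENNReal.continuous_ofReal.tendsto _).comp ?_
        have h := (Real.tendsto_exp_atBot.const_sub 1).const_mul q
        simpa using h
      exact le_of_tendsto' hlim fun s =>
        le_iSup (fun s : ℝ => ENNReal.ofReal (0 * s + q * (1 - Real.exp s))) s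
    · refine le_iSup_of_le (Real.log p - Real.log q) (ENNReal.ofReal_le_ofReal ?_)
      rw [Real.exp_sub, Real.exp_log hp, Real.exp_log hq]
      apply le_of_eq
      field_simp
      ring

theorem klTerm_zero_zero : klTerm 0 0 = 0 := by simp [klTerm]

theorem klTerm_zero_right {p : ℝ} (hp : 0 < p) : klTerm p 0 = ⊤ := by
  refine ENNReal.eq_top_of_forall_nnreal_le fun r => ?_
  refine le_iSup_of_le ((r : ℝ) / p) ?_
  rw [zero_mul, add_zero, mul_div_cancel₀ _ hp.ne', ENNReal.ofReal_coe_nnreal]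

theorem klTerm_convex {a b : ℝ} (ha : 0 ≤ a) (hb : 0 ≤ b) (p p' q q' : ℝ) :
    klTerm (a * p + b * p') (a * q + b * q') ≤
      ENNReal.ofReal a * klTerm p q + ENNReal.ofReal b * klTerm p' q' := by
  refine iSup_le fun s => ?_
  calc _ = ENNReal.ofReal (a * (p * s + q * (1 - Real.exp s))
          + b * (p' * s + q' * (1 - Real.exp s))) := by congr 1; ring
    _ ≤ _ := ENNReal.ofReal_add_le
    _ ≤ _ := by
        rw [ENNReal.ofReal_mul ha, ENNReal.ofReal_mul hb]
        gcongr
        · exact le_iSup (fun s : ℝ => ENNReal.ofReal (p * s + q * (1 - Real.exp s))) s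
        · exact le_iSup (fun s : ℝ => ENNReal.ofReal (p' * s + q' * (1 - Real.exp s))) s

theorem klTerm_smul {w : ℝ} (hw : 0 ≤ w) (p q : ℝ) :
    klTerm (w * p) (w * q) = ENNReal.ofReal w * klTerm p q := by
  rw [klTerm, klTerm, ENNReal.mul_iSup]
  refine iSup_congr fun s => ?_
  rw [← ENNReal.ofReal_mul hw]
  congr 1
  ring

theorem lowerSemicontinuous_klTerm {X : Type*} [TopologicalSpace X] {f : X → ℝ}
    (hf : Continuous f) (p : ℝ) : LowerSemicontinuous fun x => klTerm p (f x) :=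
  lowerSemicontinuous_iSup fun _ =>
    (ENNReal.continuous_ofReal.comp (by fun_prop)).lowerSemicontinuous

theorem mul_log_sub_log_nonneg {x q : ℝ} (hx : 0 ≤ x) (hq : 0 < q) :
    0 ≤ x * (Real.log x - Real.log q) + q - x := by
  rcases hx.eq_or_lt with rfl | hx
  · simpa using hq.le
  · have h := Real.log_le_sub_one_of_pos (div_pos hq hx)
    rw [Real.log_div hq.ne' hx.ne'] at h
    have h2 := mul_le_mul_of_nonneg_left h hx.le
    have h3 : x * (q / x - 1) = q - x := by field_simp
    nlinarith

theorem mul_log_add_le {a b x y : ℝ} (ha : 0 < a) (hb : 0 ≤ b) (hx : 0 ≤ x) (hy : 0 ≤ y) :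
    a * x * (Real.log a + Real.log x) ≤ a * x * Real.log (a * x + b * y) := by
  rcases hx.eq_or_lt with rfl | hx
  · simp
  · rw [← Real.log_mul ha.ne' hx.ne']
    gcongr
    nlinarith [mul_nonneg hb hy]

/-- Monotonicity of the logarithm suffices: $\log(ap+bp')$ is at least $\log(ap)$ and at least
$\log(bp')$ wherever these carry weight. The error is linear in $p,p'$, so summing over outcomes
leaves the entropy of $(a,b)$. -/
theorem klTerm_almost_concave {a b : ℝ} (ha : 0 < a) (hb : 0 < b) (hab : a + b = 1) {p p' q : ℝ}
    (hp : 0 ≤ p) (hp' : 0 ≤ p') (hq : 0 ≤ q) :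
    ENNReal.ofReal a * klTerm p q + ENNReal.ofReal b * klTerm p' q ≤
      klTerm (a * p + b * p') q +
        ENNReal.ofReal (p * (-(a * Real.log a)) + p' * (-(b * Real.log b))) := by
  rcases hq.eq_or_lt with rfl | hq
  · rcases (add_nonneg (mul_nonneg ha.le hp) (mul_nonneg hb.le hp')).eq_or_lt with h | h
    · have h1 : p = 0 := by nlinarith [mul_nonneg ha.le hp, mul_nonneg hb.le hp']
      have h2 : p' = 0 := by nlinarith [mul_nonneg ha.le hp, mul_nonneg hb.le hp']
      subst h1 h2
      simp [klTerm_zero_zero]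
    · rw [klTerm_zero_right h, top_add]
      exact le_top
  · have hpp : 0 ≤ a * p + b * p' := by positivity
    have hla : Real.log a ≤ 0 := Real.log_nonpos ha.le (by linarith)
    have hlb : Real.log b ≤ 0 := Real.log_nonpos hb.le (by linarith)
    have hna : 0 ≤ -(a * Real.log a) := by nlinarith
    have hnb : 0 ≤ -(b * Real.log b) := by nlinarith
    rw [klTerm_of_pos hp hq, klTerm_of_pos hp' hq, klTerm_of_pos hpp hq,
      ← ENNReal.ofReal_mul ha.le, ← ENNReal.ofReal_mul hb.le,
      ← ENNReal.ofReal_add (mul_nonneg ha.le (mul_log_sub_log_nonneg hp hq)) (mul_nonneg hb.le (mul_log_sub_log_nonneg hp' hq)),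
      ← ENNReal.ofReal_add (mul_log_sub_log_nonneg hpp hq) (by positivity)]
    apply ENNReal.ofReal_le_ofReal
    have h1 := mul_log_add_le ha hb.le hp hp'
    have h2 := mul_log_add_le hb ha.le hp' hp
    rw [add_comm (b * p')] at h2
    have h3 : b = 1 - a := by linarith
    have h4 : (a + b) * q = q := by rw [hab, one_mul]
    linarith

/-! ### Outcome distributions and their divergence -/

theorem cfc_diagonal_ofReal {n : Type u} [Fintype n] [DecidableEq n] (f : ℝ → ℝ) (r : n → ℝ) :
    cfc f (Matrix.diagonal fun i => (r i : ℂ)) = Matrix.diagonal fun i => ((f (r i) : ℝ) : ℂ) := by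
  classical
  set A : Matrix n n ℂ := Matrix.diagonal fun i => (r i : ℂ) with hA
  have hsa : IsSelfAdjoint A := by
    rw [isSelfAdjoint_iff, Matrix.star_eq_conjTranspose, hA, Matrix.diagonal_conjTranspose]
    congr 1
    ext i
    simp
  -- Only the values on the finite spectrum matter, so an interpolating polynomial replaces `f`.
  let p : Polynomial ℝ := Lagrange.interpolate (Finset.univ.image r) id f
  have hp : ∀ i, p.eval (r i) = f (r i) := fun i =>
    Lagrange.eval_interpolate_at_node (v := id) f (Function.injective_id.injOn)
      (Finset.mem_image_of_mem r (Finset.mem_univ i))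
  have hcongr : cfc f A = cfc p.eval A := by
    refine cfc_congr fun x hx => ?_
    rw [← spectrum.algebraMap_mem_iff ℂ, hA, spectrum_diagonal] at hx
    obtain ⟨i, hi⟩ := hx
    have : r i = x := by simpa using hi
    rw [← this, hp]
  rw [hcongr, cfc_polynomial p A hsa]
  have h1 : A = Matrix.diagonalAlgHom ℝ (fun i => (r i : ℂ)) := rfl
  rw [h1, Polynomial.aeval_algHom_apply]
  change Matrix.diagonal _ = _
  congr 1
  ext i
  rw [Polynomial.aeval_pi_apply₂]
  have := Polynomial.aeval_algebraMap_apply ℂ (r i) p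
  simpa [hp] using this

namespace Measurement

variable {d : Type v} [Fintype d] [DecidableEq d] (M : Measurement.{u, v} d)

/-- The probability of an outcome. -/
noncomputable def prob (ρ : Matrix d d ℂ) (i : M.Outcome) : ℝ := (ρ * M.effect i).trace.re

theorem prob_add_smul (a b : ℝ) (ρ ρ' : Matrix d d ℂ) (i : M.Outcome) :
    M.prob (a • ρ + b • ρ') i = a * M.prob ρ i + b * M.prob ρ' i := by
  simp [prob, add_mul, Matrix.trace_add, Matrix.trace_smul]

theorem continuous_prob (i : M.Outcome) : Continuous fun ρ => M.prob ρ i := by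
  unfold prob
  fun_prop

theorem sum_prob (ρ : Matrix d d ℂ) : ∑ i, M.prob ρ i = ρ.trace.re := by
  simp only [prob]
  rw [← Complex.re_sum, ← Matrix.trace_sum, ← Finset.mul_sum, M.sum_eq_one, mul_one]

end Measurement

theorem trace_mul_nonneg_of_posSemidef {d : Type v} [Fintype d] [DecidableEq d]
    {A B : Matrix d d ℂ} (hA : A.PosSemidef) (hB : B.PosSemidef) : 0 ≤ (A * B).trace := by
  obtain ⟨C, rfl⟩ : ∃ C : Matrix d d ℂ, A = Cᴴ * C := by
    open scoped MatrixOrder in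
    exact CStarAlgebra.nonneg_iff_eq_star_mul_self.1 hA.nonneg
  rw [mul_assoc, Matrix.trace_mul_comm]
  exact (hB.mul_mul_conjTranspose_same C).trace_nonneg

namespace Measurement

variable {d : Type v} [Fintype d] [DecidableEq d] (M : Measurement.{u, v} d)

theorem prob_nonneg {ρ : Matrix d d ℂ} (hρ : ρ.PosSemidef) (i : M.Outcome) : 0 ≤ M.prob ρ i :=
  (Complex.nonneg_iff.1 (trace_mul_nonneg_of_posSemidef hρ (M.posSemidef i))).1

theorem channel_eq_diagonal [DecidableEq M.Outcome] {ρ : Matrix d d ℂ} (hρ : ρ.PosSemidef) :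
    M.channel ρ = Matrix.diagonal fun i => (M.prob ρ i : ℂ) := by
  have h : ∀ i, (ρ * M.effect i).trace = (M.prob ρ i : ℂ) := fun i =>
    (Complex.eq_re_of_ofReal_le (r := 0) (by
      simpa using trace_mul_nonneg_of_posSemidef hρ (M.posSemidef i)))
  ext j k
  simp only [channel, h, Matrix.sum_apply, Matrix.smul_apply, Matrix.single_apply,
    Matrix.diagonal_apply]
  by_cases hjk : j = k
  · subst hjk
    simp
  · rw [if_neg hjk]
    refine Finset.sum_eq_zero fun i _ => ?_
    rw [if_neg (fun h => hjk (h.1.symm.trans h.2)), smul_zero]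

/-- The classical relative entropy of the outcome distributions. -/
noncomputable def outcomeRelEntropy (ρ σ : Matrix d d ℂ) : ℝ≥0∞ :=
  ∑ i, klTerm (M.prob ρ i) (M.prob σ i)

theorem relEntropy_eq_outcomeRelEntropy {ρ σ : Matrix d d ℂ} (hρ : IsQuantumState ρ)
    (hσ : IsQuantumState σ) : M.relEntropy ρ σ = M.outcomeRelEntropy ρ σ := by
  classical
  have hsupp : (∀ x : M.Outcome → ℂ, M.channel σ *ᵥ x = 0 → M.channel ρ *ᵥ x = 0) ↔
      ∀ i, M.prob σ i = 0 → M.prob ρ i = 0 := by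
    rw [M.channel_eq_diagonal hρ.1, M.channel_eq_diagonal hσ.1]
    constructor
    · intro h i hi
      have := congrFun (h (Pi.single i 1) (by
        ext j
        by_cases hj : j = i
        · subst hj; simp [Matrix.mulVec_diagonal, hi]
        · simp [Matrix.mulVec_diagonal, hj])) i
      simpa [Matrix.mulVec_diagonal] using this
    · intro h x hx
      ext i
      have hi := congrFun hx i
      simp only [Matrix.mulVec_diagonal, Pi.zero_apply, mul_eq_zero, Complex.ofReal_eq_zero]
        at hi ⊢
      exact hi.imp_left (h i)
  unfold relEntropy quantumRelEntropy
  split_ifs with hc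
  · rw [hsupp] at hc
    have hterm : ∀ i, klTerm (M.prob ρ i) (M.prob σ i) = ENNReal.ofReal (M.prob ρ i *
        (Real.log (M.prob ρ i) - Real.log (M.prob σ i)) + M.prob σ i - M.prob ρ i) := by
      intro i
      rcases (M.prob_nonneg hσ.1 i).eq_or_lt with h | h
      · rw [← h, hc i h.symm]
        simp [klTerm_zero_zero]
      · exact klTerm_of_pos (M.prob_nonneg hρ.1 i) h
    have hnn : ∀ i, 0 ≤ M.prob ρ i *
        (Real.log (M.prob ρ i) - Real.log (M.prob σ i)) + M.prob σ i - M.prob ρ i := by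
      intro i
      rcases (M.prob_nonneg hρ.1 i).eq_or_lt with h | h
      · rw [← h]
        simpa using M.prob_nonneg hσ.1 i
      · have hq : 0 < M.prob σ i :=
          lt_of_le_of_ne (M.prob_nonneg hσ.1 i) fun h0 => h.ne' (hc i h0.symm)
        exact mul_log_sub_log_nonneg h.le hq
    rw [outcomeRelEntropy, Finset.sum_congr rfl fun i _ => hterm i,
      ← ENNReal.ofReal_sum_of_nonneg fun i _ => hnn i]
    congr 1
    -- The corrections $q-p$ cancel in total because both states have trace one.
    rw [Finset.sum_sub_distrib, Finset.sum_add_distrib, sum_prob, sum_prob, hρ.2, hσ.2,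
      add_sub_cancel_right]
    rw [M.channel_eq_diagonal hρ.1, M.channel_eq_diagonal hσ.1]
    have e : ∀ r : M.Outcome → ℝ,
        cfc Real.log (Matrix.diagonal fun i => (r i : ℂ)) =
          Matrix.diagonal fun i => ((Real.log (r i) : ℝ) : ℂ) :=
      fun r => cfc_diagonal_ofReal Real.log r
    rw [e, e, Matrix.diagonal_sub, Matrix.diagonal_mul_diagonal, Matrix.trace_diagonal,
      Complex.re_sum]
    refine Finset.sum_congr rfl fun i _ => ?_
    rw [← Complex.ofReal_sub, ← Complex.ofReal_mul, Complex.ofReal_re]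
  · rw [hsupp] at hc
    push Not at hc
    obtain ⟨i, hi, hi'⟩ := hc
    symm
    rw [outcomeRelEntropy, ENNReal.sum_eq_top]
    refine ⟨i, Finset.mem_univ i, ?_⟩
    rw [hi]
    exact klTerm_zero_right (lt_of_le_of_ne (M.prob_nonneg hρ.1 i) hi'.symm)

theorem lowerSemicontinuous_outcomeRelEntropy (ρ : Matrix d d ℂ) :
    LowerSemicontinuous fun σ => M.outcomeRelEntropy ρ σ :=
  lowerSemicontinuous_sum fun i _ => lowerSemicontinuous_klTerm (M.continuous_prob i) _

theorem outcomeRelEntropy_convex {a b : ℝ} (ha : 0 ≤ a) (hb : 0 ≤ b) (ρ ρ' σ σ' : Matrix d d ℂ) :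
    M.outcomeRelEntropy (a • ρ + b • ρ') (a • σ + b • σ') ≤
      ENNReal.ofReal a * M.outcomeRelEntropy ρ σ + ENNReal.ofReal b * M.outcomeRelEntropy ρ' σ' := by
  simp only [outcomeRelEntropy, prob_add_smul, Finset.mul_sum, ← Finset.sum_add_distrib]
  exact Finset.sum_le_sum fun i _ => klTerm_convex ha hb _ _ _ _

theorem outcomeRelEntropy_almost_concave {a b : ℝ} (ha : 0 < a) (hb : 0 < b) (hab : a + b = 1)
    {ρ ρ' σ : Matrix d d ℂ} (hρ : IsQuantumState ρ) (hρ' : IsQuantumState ρ')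
    (hσ : IsQuantumState σ) :
    ENNReal.ofReal a * M.outcomeRelEntropy ρ σ + ENNReal.ofReal b * M.outcomeRelEntropy ρ' σ ≤
      M.outcomeRelEntropy (a • ρ + b • ρ') σ +
        ENNReal.ofReal (-(a * Real.log a) + -(b * Real.log b)) := by
  have hla : Real.log a ≤ 0 := Real.log_nonpos ha.le (by linarith)
  have hlb : Real.log b ≤ 0 := Real.log_nonpos hb.le (by linarith)
  have hna : 0 ≤ -(a * Real.log a) := by nlinarith
  have hnb : 0 ≤ -(b * Real.log b) := by nlinarith
  have hsum : ∑ i, (M.prob ρ i * (-(a * Real.log a)) + M.prob ρ' i * (-(b * Real.log b))) =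
      -(a * Real.log a) + -(b * Real.log b) := by
    rw [Finset.sum_add_distrib, ← Finset.sum_mul, ← Finset.sum_mul, sum_prob, sum_prob, hρ.2, hρ'.2]
    simp
  rw [← hsum, ENNReal.ofReal_sum_of_nonneg fun i _ => add_nonneg
    (mul_nonneg (M.prob_nonneg hρ.1 i) hna) (mul_nonneg (M.prob_nonneg hρ'.1 i) hnb)]
  simp only [outcomeRelEntropy, prob_add_smul, Finset.mul_sum, ← Finset.sum_add_distrib]
  exact Finset.sum_le_sum fun i _ => klTerm_almost_concave ha hb hab (M.prob_nonneg hρ.1 i)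
    (M.prob_nonneg hρ'.1 i) (M.prob_nonneg hσ.1 i)

theorem outcomeRelEntropy_disjointMix {m : ℕ} (w : Fin m → ℝ) (hw : ∀ k, 0 ≤ w k)
    (hw1 : ∑ k, w k = 1) (N : Fin m → Measurement.{u, v} d) (ρ σ : Matrix d d ℂ) :
    (disjointMix w hw hw1 N).outcomeRelEntropy ρ σ =
      ∑ k, ENNReal.ofReal (w k) * (N k).outcomeRelEntropy ρ σ := by
  have h : ∀ (τ : Matrix d d ℂ) (x : Σ k, (N k).Outcome),
      (disjointMix w hw hw1 N).prob τ x = w x.1 * (N x.1).prob τ x.2 := by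
    intro τ x
    simp [prob, disjointMix, Matrix.trace_smul]
  change ∑ x : Σ k, (N k).Outcome, klTerm ((disjointMix w hw hw1 N).prob ρ x)
    ((disjointMix w hw hw1 N).prob σ x) = _
  rw [Fintype.sum_sigma]
  refine Finset.sum_congr rfl fun k _ => ?_
  rw [outcomeRelEntropy, Finset.mul_sum]
  refine Finset.sum_congr rfl fun i _ => ?_
  rw [h, h, klTerm_smul (hw k)]

end Measurement

/-! ### Minimax -/

/-- Hahn–Banach separates the open orthant $\{v<c\}$ from the convex set of vectors dominating some
value vector $(f_k(x))_k$. The normalised separating functional provides the weights. -/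
theorem exists_weights_of_convex_of_lt {E : Type*} [AddCommGroup E] [Module ℝ E] {D : Set E}
    (hD : Convex ℝ D) {m : ℕ} (hm : 0 < m) (f : Fin m → E → ℝ) (hf : ∀ k, ConvexOn ℝ D (f k))
    {c : ℝ} (h : ∀ x ∈ D, ∃ k, c ≤ f k x) :
    ∃ w : Fin m → ℝ, (∀ k, 0 ≤ w k) ∧ ∑ k, w k = 1 ∧ ∀ x ∈ D, c ≤ ∑ k, w k * f k x := by
  rcases D.eq_empty_or_nonempty with rfl | ⟨x₀, hx₀⟩
  · refine ⟨Pi.single ⟨0, hm⟩ 1, fun k => ?_, by simp, by simp⟩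
    rw [Pi.single_apply]
    split_ifs <;> norm_num
  let s : Set (Fin m → ℝ) := Set.univ.pi fun _ => Set.Iio c
  let t : Set (Fin m → ℝ) := {v | ∃ x ∈ D, ∀ k, f k x ≤ v k}
  have hs : Convex ℝ s := convex_pi fun _ _ => convex_Iio c
  have hso : IsOpen s := isOpen_set_pi Set.finite_univ fun _ _ => isOpen_Iio
  have ht : Convex ℝ t := by
    rintro v ⟨x, hx, hv⟩ v' ⟨x', hx', hv'⟩ a b ha hb hab
    refine ⟨a • x + b • x', hD hx hx' ha hb hab, fun k => ?_⟩
    refine ((hf k).2 hx hx' ha hb hab).trans ?_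
    simp only [smul_eq_mul, Pi.add_apply, Pi.smul_apply]
    gcongr
    · exact hv k
    · exact hv' k
  have hdisj : Disjoint s t := by
    rw [Set.disjoint_left]
    rintro v hv ⟨x, hx, hvx⟩
    obtain ⟨k, hk⟩ := h x hx
    exact absurd (hk.trans (hvx k)) (not_le.2 (hv k trivial))
  obtain ⟨L, u, hLs, hLt⟩ := geometric_hahn_banach_open hs hso ht hdisj
  let a : Fin m → ℝ := fun k => L (Pi.single k 1)
  have hL : ∀ v, L v = ∑ k, a k * v k := by
    intro v
    conv_lhs => rw [← Finset.univ_sum_single v, map_sum]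
    refine Finset.sum_congr rfl fun k _ => ?_
    have : (Pi.single k (v k) : Fin m → ℝ) = v k • Pi.single k 1 := by
      rw [← Pi.single_smul', smul_eq_mul, mul_one]
    rw [this, map_smul, smul_eq_mul, mul_comm]
  have ha : ∀ k, 0 ≤ a k := by
    intro k
    by_contra hk
    push Not at hk
    -- The orthant is unbounded in direction $-e_k$, so a negative coefficient would make `L`
    -- unbounded above on it.
    have hconst : ∀ n : ℝ, 0 ≤ n → (fun _ => c - 1) - n • (Pi.single k 1 : Fin m → ℝ) ∈ s := by
      intro n hn j _
      have : 0 ≤ n * (Pi.single k 1 : Fin m → ℝ) j := by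
        refine mul_nonneg hn ?_
        rw [Pi.single_apply]
        split_ifs <;> norm_num
      simp only [Pi.sub_apply, Pi.smul_apply, smul_eq_mul, Set.mem_Iio]
      linarith
    have h1 := hLs _ (hconst ((|u| + |L fun _ => c - 1|) / (-a k)) (by
      have : 0 < -a k := by linarith
      positivity))
    rw [map_sub, map_smul, smul_eq_mul] at h1
    change (L fun _ => c - 1) - (|u| + |L fun _ => c - 1|) / (-a k) * a k < u at h1
    have h2 : (|u| + |L fun _ => c - 1|) / (-a k) * a k = -(|u| + |L fun _ => c - 1|) := by
      have := hk.ne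
      field_simp
    rw [h2] at h1
    linarith [le_abs_self u, neg_abs_le (L fun _ => c - 1)]
  have hcu : c * ∑ k, a k ≤ u := by
    have hlim : Filter.Tendsto (fun δ : ℝ => (c - δ) * ∑ k, a k) (nhdsWithin 0 (Set.Ioi 0))
        (nhds (c * ∑ k, a k)) := by
      have : Continuous fun δ : ℝ => (c - δ) * ∑ k, a k := by fun_prop
      simpa using (this.tendsto 0).mono_left nhdsWithin_le_nhds
    refine le_of_tendsto hlim ?_
    filter_upwards [self_mem_nhdsWithin] with δ hδ
    have := hLs (fun _ => c - δ) fun k _ => by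
      simp only [Set.mem_Iio, Set.mem_Ioi] at hδ ⊢
      linarith
    rw [hL, ← Finset.sum_mul, mul_comm] at this
    exact this.le
  have hLt' : ∀ x ∈ D, u ≤ ∑ k, a k * f k x := fun x hx => by
    rw [← hL fun k => f k x]
    exact hLt _ ⟨x, hx, fun _ => le_rfl⟩
  have hpos : 0 < ∑ k, a k := by
    refine lt_of_le_of_ne (Finset.sum_nonneg fun k _ => ha k) fun h0 => ?_
    have h0' : ∀ k, a k = 0 := fun k =>
      (Finset.sum_eq_zero_iff_of_nonneg fun k _ => ha k).1 h0.symm k (Finset.mem_univ k)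
    have h1 := hLs (fun _ => c - 1) fun k _ => by simp
    have h2 := hLt' x₀ hx₀
    rw [hL] at h1
    simp only [h0', zero_mul, Finset.sum_const_zero] at h1 h2
    linarith
  refine ⟨fun k => a k / ∑ j, a j, fun k => div_nonneg (ha k) hpos.le, ?_, fun x hx => ?_⟩
  · rw [← Finset.sum_div, div_self hpos.ne']
  · have : ∑ k, a k / (∑ j, a j) * f k x = (∑ k, a k * f k x) / ∑ j, a j := by
      rw [Finset.sum_div]
      exact Finset.sum_congr rfl fun k _ => by ring
    rw [this, le_div_iff₀ hpos]
    exact hcu.trans (hLt' x hx)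

/-- A minimax theorem for a family of `[0, ∞]`-valued lower semicontinuous convex functions
that is closed under finite convex combinations. -/
theorem iInf_iSup_le_iSup_iInf_of_mix {E ι : Type*} [AddCommGroup E] [Module ℝ E]
    [TopologicalSpace E] {χ : Set E} (hχ : Convex ℝ χ) (hc : IsCompact χ) (hne : χ.Nonempty)
    (f : ι → E → ℝ≥0∞) (hlsc : ∀ i, LowerSemicontinuous (f i))
    (hconv : ∀ i, ∀ x y, ∀ a b : ℝ, 0 ≤ a → 0 ≤ b → a + b = 1 →
      f i (a • x + b • y) ≤ ENNReal.ofReal a * f i x + ENNReal.ofReal b * f i y)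
    (hmix : ∀ (m : ℕ) (w : Fin m → ℝ), (∀ k, 0 ≤ w k) → ∑ k, w k = 1 → ∀ i : Fin m → ι,
      ∃ j, ∀ x, ∑ k, ENNReal.ofReal (w k) * f (i k) x ≤ f j x) :
    ⨅ x ∈ χ, ⨆ i, f i x ≤ ⨆ i, ⨅ x ∈ χ, f i x := by
  by_contra hlt
  rw [not_le] at hlt
  obtain ⟨c', hc', hlt'⟩ := ENNReal.lt_iff_exists_nnreal_btwn.1 hlt
  -- The gap between `c'` and `c` pays for perturbing the weights later.
  obtain ⟨c, hcc, hc2⟩ := ENNReal.lt_iff_exists_nnreal_btwn.1 hlt'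
  have hcc : (c' : ℝ) < c := by exact_mod_cast hcc
  have hc'0 : (0 : ℝ) ≤ c' := c'.2
  -- finitely many of the functions suffice
  obtain ⟨F, hF⟩ := hc.elim_finite_subfamily_closed (fun i => f i ⁻¹' Set.Iic (c : ℝ≥0∞))
    (fun i => lowerSemicontinuous_iff_isClosed_preimage.1 (hlsc i) _) (by
      rw [Set.eq_empty_iff_forall_notMem]
      rintro x ⟨hx, hx'⟩
      rw [Set.mem_iInter] at hx'
      exact absurd ((iInf₂_le x hx).trans (iSup_le hx')) (not_le.2 hc2))
  have hF' : ∀ x ∈ χ, ∃ i ∈ F, (c : ℝ≥0∞) < f i x := by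
    intro x hx
    by_contra hcon
    push Not at hcon
    rw [Set.eq_empty_iff_forall_notMem] at hF
    exact hF x ⟨hx, Set.mem_iInter₂.2 hcon⟩
  have hm : 0 < F.card := by
    obtain ⟨x, hx⟩ := hne
    obtain ⟨i, hi, -⟩ := hF' x hx
    exact Finset.card_pos.2 ⟨i, hi⟩
  set m := F.card with hmdef
  let g : Fin m → ι := fun k => (F.equivFin.symm k : ι)
  have hg : ∀ x ∈ χ, ∃ k, (c : ℝ≥0∞) < f (g k) x := by
    intro x hx
    obtain ⟨i, hi, h⟩ := hF' x hx
    exact ⟨F.equivFin ⟨i, hi⟩, by simpa [g] using h⟩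
  -- Separation needs real values, so it is applied only where all chosen functions are finite.
  let D : Set E := {x | x ∈ χ ∧ ∀ k, f (g k) x ≠ ⊤}
  have hfin : ∀ k, ∀ x ∈ D, ∀ y ∈ D, ∀ a b : ℝ,
      ENNReal.ofReal a * f (g k) x + ENNReal.ofReal b * f (g k) y ≠ ⊤ := fun k x hx y hy a b =>
    ENNReal.add_ne_top.2 ⟨ENNReal.mul_ne_top ENNReal.ofReal_ne_top (hx.2 k),
      ENNReal.mul_ne_top ENNReal.ofReal_ne_top (hy.2 k)⟩
  have hD : Convex ℝ D := by
    intro x hx y hy a b ha hb hab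
    exact ⟨hχ hx.1 hy.1 ha hb hab, fun k =>
      ne_top_of_le_ne_top (hfin k x hx y hy a b) (hconv _ x y a b ha hb hab)⟩
  obtain ⟨w, hw, hw1, hwD⟩ := exists_weights_of_convex_of_lt hD hm (c := c)
    (fun k x => (f (g k) x).toReal) (fun k => ⟨hD, fun x hx y hy a b ha hb hab => by
      have h := ENNReal.toReal_mono (hfin k x hx y hy a b) (hconv (g k) x y a b ha hb hab)
      rw [ENNReal.toReal_add (ENNReal.mul_ne_top ENNReal.ofReal_ne_top (hx.2 k))
        (ENNReal.mul_ne_top ENNReal.ofReal_ne_top (hy.2 k)), ENNReal.toReal_mul,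
        ENNReal.toReal_mul, ENNReal.toReal_ofReal ha, ENNReal.toReal_ofReal hb] at h
      exact h⟩) (fun x hx => by
        obtain ⟨k, hk⟩ := hg x hx.1
        refine ⟨k, ?_⟩
        have := ENNReal.toReal_mono (hx.2 k) hk.le
        simpa using this)
  -- make all weights positive
  have hc0 : (0 : ℝ) < c := hc'0.trans_lt hcc
  have hm' : (0 : ℝ) < m := by exact_mod_cast hm
  set δ : ℝ := (c - c') / c with hδ
  have hδ0 : 0 < δ := div_pos (by linarith) hc0
  have hδ1 : (1 - δ) * c = c' := by
    rw [hδ]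
    field_simp
    ring
  have hδ2 : 0 ≤ 1 - δ := by
    by_contra hneg
    push Not at hneg
    nlinarith
  -- Outside `D` some function is infinite, but a zero weight would erase it since $0\cdot\infty=0$.
  -- Mixing in the uniform weights prevents this, and `δ` is chosen so that $(1-\delta)c=c'$.
  let w' : Fin m → ℝ := fun k => (1 - δ) * w k + δ / m
  have hw'0 : ∀ k, 0 < w' k := fun k =>
    add_pos_of_nonneg_of_pos (mul_nonneg hδ2 (hw k)) (div_pos hδ0 hm')
  have hw'1 : ∑ k, w' k = 1 := by
    simp only [w', Finset.sum_add_distrib, ← Finset.mul_sum, hw1, Finset.sum_const,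
      Finset.card_univ, Fintype.card_fin, nsmul_eq_mul]
    field_simp
    ring
  obtain ⟨j, hj⟩ := hmix m w' (fun k => (hw'0 k).le) hw'1 g
  refine absurd (le_iSup_of_le j (le_iInf₂ fun x hx => ?_)) (not_le.2 hc')
  refine le_trans ?_ (hj x)
  by_cases hxD : x ∈ D
  · have e : ∑ k, ENNReal.ofReal (w' k) * f (g k) x =
        ENNReal.ofReal (∑ k, w' k * (f (g k) x).toReal) := by
      rw [ENNReal.ofReal_sum_of_nonneg fun k _ =>
        mul_nonneg (hw'0 k).le ENNReal.toReal_nonneg]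
      refine Finset.sum_congr rfl fun k _ => ?_
      rw [ENNReal.ofReal_mul (hw'0 k).le, ENNReal.ofReal_toReal (hxD.2 k)]
    rw [e, ← ENNReal.ofReal_coe_nnreal]
    apply ENNReal.ofReal_le_ofReal
    rw [← hδ1]
    calc (1 - δ) * c ≤ (1 - δ) * ∑ k, w k * (f (g k) x).toReal :=
          mul_le_mul_of_nonneg_left (hwD x hxD) hδ2
      _ ≤ _ := by
        rw [Finset.mul_sum]
        refine Finset.sum_le_sum fun k _ => ?_
        rw [← mul_assoc]
        exact mul_le_mul_of_nonneg_right (le_add_of_nonneg_right (div_pos hδ0 hm').le)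
          ENNReal.toReal_nonneg
  · have : ∃ k, f (g k) x = ⊤ := by
      by_contra hcon
      push Not at hcon
      exact hxD ⟨hx, hcon⟩
    obtain ⟨k, hk⟩ := this
    have htop : ∑ k, ENNReal.ofReal (w' k) * f (g k) x = ⊤ := by
      rw [ENNReal.sum_eq_top]
      refine ⟨k, Finset.mem_univ k, ?_⟩
      rw [hk, ENNReal.mul_top]
      simpa using hw'0 k
    rw [htop]
    exact le_top

/-! ### Trace distance and mixing of states -/

/-- These are the positive and negative parts: $|A|=P+N$, and vanishing trace splits $\|A\|_1$
evenly. -/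
theorem exists_posSemidef_sub_eq {d : Type v} [Fintype d] [DecidableEq d] {A : Matrix d d ℂ}
    (hA : A.IsHermitian) (htr : A.trace = 0) :
    ∃ P N : Matrix d d ℂ, P.PosSemidef ∧ N.PosSemidef ∧ A = P - N ∧
      P.trace = ((1 / 2 * traceNorm A : ℝ) : ℂ) ∧ N.trace = ((1 / 2 * traceNorm A : ℝ) : ℂ) := by
  have hsa : IsSelfAdjoint A := hA
  have hcont : ∀ f : ℝ → ℝ, ContinuousOn f (spectrum ℝ A) := fun f =>
    (Matrix.finite_real_spectrum (A := A)).continuousOn f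
  have hpsd : ∀ f : ℝ → ℝ, (∀ x, 0 ≤ f x) → (cfc f A).PosSemidef := by
    intro f hf
    open scoped MatrixOrder in
    exact Matrix.nonneg_iff_posSemidef.1 (cfc_nonneg fun x _ => hf x)
  let P := cfc (fun x : ℝ => max x 0) A
  let N := cfc (fun x : ℝ => max (-x) 0) A
  have hP : P.PosSemidef := hpsd _ fun x => le_max_right _ _
  have hN : N.PosSemidef := hpsd _ fun x => le_max_right _ _
  have hsub : A = P - N := by
    rw [← cfc_sub _ _ A (hcont _) (hcont _)]
    conv_lhs => rw [← cfc_id ℝ A]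
    refine cfc_congr fun x _ => ?_
    simp only [id]
    rcases le_total 0 x with h | h
    · rw [max_eq_left h, max_eq_right (by linarith), sub_zero]
    · rw [max_eq_right h, max_eq_left (by linarith)]; ring
  have habs : cfc Real.sqrt (Aᴴ * A) = P + N := by
    have h1 : Aᴴ * A = cfc (fun x : ℝ => x * x) A := by
      rw [cfc_mul _ _ A (hcont _) (hcont _), cfc_id' ℝ A, hA.eq]
    rw [h1, ← cfc_comp' Real.sqrt (fun x : ℝ => x * x) A (by fun_prop) (hcont _),
      ← cfc_add _ _ _ (hcont _) (hcont _)]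
    refine cfc_congr fun x _ => ?_
    simp only [Real.sqrt_mul_self_eq_abs]
    rcases le_total 0 x with h | h
    · rw [max_eq_left h, max_eq_right (by linarith), add_zero, abs_of_nonneg h]
    · rw [max_eq_right h, max_eq_left (by linarith), zero_add, abs_of_nonpos h]
  have hPN : P.trace = N.trace := by
    rw [hsub, Matrix.trace_sub, sub_eq_zero] at htr
    exact htr
  have hPre : P.trace = (P.trace.re : ℂ) :=
    Complex.eq_re_of_ofReal_le (r := 0) (by simpa using hP.trace_nonneg)
  have htn : 1 / 2 * traceNorm A = P.trace.re := by
    rw [traceNorm, habs, Matrix.trace_add, ← hPN, Complex.add_re]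
    ring
  refine ⟨P, N, hP, hN, hsub, ?_, ?_⟩
  · rw [htn, ← hPre]
  · rw [htn, ← hPre, hPN]

theorem traceNorm_nonneg {d : Type v} [Fintype d] [DecidableEq d] (A : Matrix d d ℂ) :
    0 ≤ traceNorm A := by
  have h : (cfc Real.sqrt (Aᴴ * A)).PosSemidef := by
    open scoped MatrixOrder in
    exact Matrix.nonneg_iff_posSemidef.1 (cfc_nonneg fun x _ => Real.sqrt_nonneg x)
  exact (Complex.nonneg_iff.1 h.trace_nonneg).1

theorem IsQuantumState.convexCombination {d : Type v} [Fintype d] {ρ σ : Matrix d d ℂ}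
    (hρ : IsQuantumState ρ) (hσ : IsQuantumState σ) {a b : ℝ} (ha : 0 ≤ a) (hb : 0 ≤ b)
    (hab : a + b = 1) : IsQuantumState (a • ρ + b • σ) := by
  refine ⟨(hρ.1.smul ha).add (hσ.1.smul hb), ?_⟩
  rw [Matrix.trace_add, Matrix.trace_smul, Matrix.trace_smul, hρ.2, hσ.2, ← add_smul, hab, one_smul]

theorem eq_of_traceNorm_sub_le_zero {d : Type v} [Fintype d] [DecidableEq d] {ρ ρ' : Matrix d d ℂ}
    (hρ : IsQuantumState ρ) (hρ' : IsQuantumState ρ') (h : 1 / 2 * traceNorm (ρ - ρ') ≤ 0) :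
    ρ = ρ' := by
  obtain ⟨P, N, hP, hN, hPN, hPt, hNt⟩ := exists_posSemidef_sub_eq
    (hρ.1.isHermitian.sub hρ'.1.isHermitian) (by rw [Matrix.trace_sub, hρ.2, hρ'.2, sub_self])
  have h0 : 1 / 2 * traceNorm (ρ - ρ') = 0 :=
    le_antisymm h (mul_nonneg (by norm_num) (traceNorm_nonneg _))
  rw [h0, Complex.ofReal_zero] at hPt hNt
  rw [hP.trace_eq_zero_iff.1 hPt, hN.trace_eq_zero_iff.1 hNt, sub_zero] at hPN
  exact sub_eq_zero.1 hPN

/-- Two states at trace distance at most `ε` become equal after mixing in suitable states. -/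
theorem exists_states_add_smul_eq {d : Type v} [Fintype d] [DecidableEq d] {ρ ρ' : Matrix d d ℂ}
    (hρ : IsQuantumState ρ) (hρ' : IsQuantumState ρ') {ε : ℝ} (hε0 : 0 < ε)
    (hε : 1 / 2 * traceNorm (ρ - ρ') ≤ ε) :
    ∃ μ ν : Matrix d d ℂ, IsQuantumState μ ∧ IsQuantumState ν ∧ ρ + ε • μ = ρ' + ε • ν := by
  obtain ⟨P, N, hP, hN, hPN, hPt, hNt⟩ := exists_posSemidef_sub_eq
    (hρ.1.isHermitian.sub hρ'.1.isHermitian) (by rw [Matrix.trace_sub, hρ.2, hρ'.2, sub_self])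
  set t := 1 / 2 * traceNorm (ρ - ρ')
  -- Padding both parts with the same multiple of `ρ` raises their trace from `t` to `ε` and leaves
  -- $P-N$ unchanged.
  have hstate : ∀ Q : Matrix d d ℂ, Q.PosSemidef → Q.trace = (t : ℂ) →
      IsQuantumState (ε⁻¹ • (Q + (ε - t) • ρ)) := by
    intro Q hQ hQt
    refine ⟨(hQ.add (hρ.1.smul (sub_nonneg.2 hε))).smul (inv_nonneg.2 hε0.le), ?_⟩
    rw [Matrix.trace_smul, Matrix.trace_add, Matrix.trace_smul, hQt, hρ.2, Complex.real_smul,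
      Complex.real_smul, mul_one, ← Complex.ofReal_add, ← Complex.ofReal_mul, add_sub_cancel,
      inv_mul_cancel₀ hε0.ne', Complex.ofReal_one]
  refine ⟨_, _, hstate N hN hNt, hstate P hP hPt, ?_⟩
  rw [smul_inv_smul₀ hε0.ne', smul_inv_smul₀ hε0.ne', ← add_assoc, ← add_assoc]
  congr 1
  rw [sub_eq_sub_iff_add_eq_add] at hPN
  rw [hPN, add_comm]

/-! ### Continuity for one measurement, and the exchange of infimum and supremum -/

section

variable {d : Type v} [Fintype d] [DecidableEq d] {χ : Set (Matrix d d ℂ)}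

theorem singleMeasuredDistance_eq_iInf (hχ : ∀ σ ∈ χ, IsQuantumState σ)
    (M : Measurement.{u, v} d) {ρ : Matrix d d ℂ} (hρ : IsQuantumState ρ) :
    singleMeasuredDistance χ M ρ = ⨅ σ ∈ χ, M.outcomeRelEntropy ρ σ :=
  iInf_congr fun σ => iInf_congr fun hσ => M.relEntropy_eq_outcomeRelEntropy hρ (hχ σ hσ)

theorem singleMeasuredDistance_convex (hχ : ∀ σ ∈ χ, IsQuantumState σ) (hconvex : Convex ℝ χ)
    (M : Measurement.{u, v} d) {ρ ρ' : Matrix d d ℂ} (hρ : IsQuantumState ρ)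
    (hρ' : IsQuantumState ρ') {a b : ℝ} (ha : 0 < a) (hb : 0 < b) (hab : a + b = 1) :
    singleMeasuredDistance χ M (a • ρ + b • ρ') ≤
      ENNReal.ofReal a * singleMeasuredDistance χ M ρ +
        ENNReal.ofReal b * singleMeasuredDistance χ M ρ' := by
  rw [singleMeasuredDistance_eq_iInf hχ M hρ, singleMeasuredDistance_eq_iInf hχ M hρ',
    singleMeasuredDistance_eq_iInf hχ M (hρ.convexCombination hρ' ha.le hb.le hab)]
  simp only [iInf_subtype']
  rw [ENNReal.mul_iInf_of_ne (by simpa using ha) ENNReal.ofReal_ne_top,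
    ENNReal.mul_iInf_of_ne (by simpa using hb) ENNReal.ofReal_ne_top]
  exact ENNReal.le_iInf_add_iInf fun σ σ' =>
    iInf_le_of_le (⟨a • σ.1 + b • σ'.1, hconvex σ.2 σ'.2 ha.le hb.le hab⟩ : χ)
      (M.outcomeRelEntropy_convex ha.le hb.le ρ ρ' σ.1 σ'.1)

/-- Any `σ` for the mixture is also a candidate in both infima on the left, so convexity of `χ`
plays no role. -/
theorem singleMeasuredDistance_almost_concave (hχ : ∀ σ ∈ χ, IsQuantumState σ)
    (M : Measurement.{u, v} d) {ρ ρ' : Matrix d d ℂ} (hρ : IsQuantumState ρ)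
    (hρ' : IsQuantumState ρ') {a b : ℝ} (ha : 0 < a) (hb : 0 < b) (hab : a + b = 1) :
    ENNReal.ofReal a * singleMeasuredDistance χ M ρ +
        ENNReal.ofReal b * singleMeasuredDistance χ M ρ' ≤
      singleMeasuredDistance χ M (a • ρ + b • ρ') +
        ENNReal.ofReal (-(a * Real.log a) + -(b * Real.log b)) := by
  rw [singleMeasuredDistance_eq_iInf hχ M hρ, singleMeasuredDistance_eq_iInf hχ M hρ',
    singleMeasuredDistance_eq_iInf hχ M (hρ.convexCombination hρ' ha.le hb.le hab)]
  simp only [ENNReal.iInf_add]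
  refine le_iInf₂ fun σ hσ => ?_
  refine le_trans ?_ (M.outcomeRelEntropy_almost_concave ha hb hab hρ hρ' (hχ σ hσ))
  gcongr
  · exact iInf₂_le σ hσ
  · exact iInf₂_le σ hσ

theorem gFun_eq_mul_entropy {ε : ℝ} (hε : 0 < ε) :
    gFun ε = (1 + ε) * (-((1 + ε)⁻¹ * Real.log (1 + ε)⁻¹) +
      -(ε * (1 + ε)⁻¹ * Real.log (ε * (1 + ε)⁻¹))) := by
  have h : 0 < 1 + ε := by linarith
  rw [Real.log_mul hε.ne' (inv_ne_zero h.ne'), Real.log_inv, gFun]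
  field_simp
  ring

theorem le_add_absDifference (a b : ℝ≥0∞) : a ≤ b + absDifference a b := by
  rw [add_comm]
  exact le_tsub_add.trans (by gcongr; exact le_max_left _ _)

theorem absDifference_le {a b c : ℝ≥0∞} (h : a ≤ b + c) (h' : b ≤ a + c) :
    absDifference a b ≤ c :=
  max_le (tsub_le_iff_left.2 h) (tsub_le_iff_left.2 h')

theorem absDifference_le_maximumVariation {𝓜 : Set (Measurement.{u, v} d)}
    {M : Measurement.{u, v} d} (hM : M ∈ 𝓜) {μ ν : Matrix d d ℂ} (hμ : IsQuantumState μ)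
    (hν : IsQuantumState ν) :
    absDifference (singleMeasuredDistance χ M μ) (singleMeasuredDistance χ M ν) ≤
      maximumVariation χ 𝓜 :=
  le_iSup₂_of_le M hM <| le_iSup₂_of_le μ ν <| le_iSup₂_of_le hμ hν le_rfl

theorem outcomeRelEntropy_self (M : Measurement.{u, v} d) {ρ : Matrix d d ℂ}
    (hρ : IsQuantumState ρ) : M.outcomeRelEntropy ρ ρ = 0 := by
  refine Finset.sum_eq_zero fun i _ => ?_
  rcases (M.prob_nonneg hρ.1 i).eq_or_lt with h | h
  · rw [← h, klTerm_zero_zero]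
  · rw [klTerm_of_pos h.le h]
    simp

theorem singleMeasuredDistance_le_maximumVariation (hχ : ∀ σ ∈ χ, IsQuantumState σ)
    (hne : χ.Nonempty) {𝓜 : Set (Measurement.{u, v} d)} {M : Measurement.{u, v} d} (hM : M ∈ 𝓜)
    {ρ : Matrix d d ℂ} (hρ : IsQuantumState ρ) :
    singleMeasuredDistance χ M ρ ≤ maximumVariation χ 𝓜 := by
  obtain ⟨σ, hσ⟩ := hne
  have h0 : singleMeasuredDistance χ M σ = 0 := by
    rw [singleMeasuredDistance_eq_iInf hχ M (hχ σ hσ), ← nonpos_iff_eq_zero]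
    exact (iInf₂_le σ hσ).trans (outcomeRelEntropy_self M (hχ σ hσ)).le
  have h := le_add_absDifference (singleMeasuredDistance χ M ρ) (singleMeasuredDistance χ M σ)
  rw [h0, zero_add] at h
  refine h.trans ?_
  rw [← h0]
  exact absDifference_le_maximumVariation hM hρ (hχ σ hσ)

theorem measuredDistance_eq_iSup (hχ : ∀ σ ∈ χ, IsQuantumState σ) (hne : χ.Nonempty)
    (hcompact : IsCompact χ) (hconvex : Convex ℝ χ) {𝓜 : Set (Measurement.{u, v} d)}
    (h𝓜 : ClosedUnderDisjointMix 𝓜) {ρ : Matrix d d ℂ} (hρ : IsQuantumState ρ) :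
    measuredDistance χ 𝓜 ρ = ⨆ M ∈ 𝓜, singleMeasuredDistance χ M ρ := by
  have h1 : measuredDistance χ 𝓜 ρ = ⨅ σ ∈ χ, ⨆ M : 𝓜, M.1.outcomeRelEntropy ρ σ := by
    refine iInf_congr fun σ => iInf_congr fun hσ => ?_
    rw [iSup_subtype']
    exact iSup_congr fun M => M.1.relEntropy_eq_outcomeRelEntropy hρ (hχ σ hσ)
  have h2 : ⨆ M ∈ 𝓜, singleMeasuredDistance χ M ρ =
      ⨆ M : 𝓜, ⨅ σ ∈ χ, M.1.outcomeRelEntropy ρ σ := by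
    rw [iSup_subtype']
    exact iSup_congr fun M => singleMeasuredDistance_eq_iInf hχ M.1 hρ
  rw [h1, h2]
  apply le_antisymm
  · refine iInf_iSup_le_iSup_iInf_of_mix hconvex hcompact hne _
      (fun M => M.1.lowerSemicontinuous_outcomeRelEntropy ρ) ?_ ?_
    · intro M σ σ' a b ha hb hab
      have h := M.1.outcomeRelEntropy_convex ha hb ρ ρ σ σ'
      rwa [← add_smul, hab, one_smul] at h
    · intro m w hw hw1 N
      exact ⟨⟨_, h𝓜 m w hw hw1 (fun k => (N k).1) fun k => (N k).2⟩, fun σ =>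
        (Measurement.outcomeRelEntropy_disjointMix w hw hw1 _ ρ σ).ge⟩
  · exact iSup_le fun M => le_iInf₂ fun σ hσ =>
      (iInf₂_le σ hσ).trans (le_iSup (fun M : 𝓜 => M.1.outcomeRelEntropy ρ σ) M)

theorem singleMeasuredDistance_le_add (hχ : ∀ σ ∈ χ, IsQuantumState σ) (hne : χ.Nonempty)
    (hconvex : Convex ℝ χ) {𝓜 : Set (Measurement.{u, v} d)} {M : Measurement.{u, v} d}
    (hM : M ∈ 𝓜) {ρ ρ' : Matrix d d ℂ} (hρ : IsQuantumState ρ) (hρ' : IsQuantumState ρ')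
    {ε : ℝ} (hε : 1 / 2 * traceNorm (ρ - ρ') ≤ ε) :
    singleMeasuredDistance χ M ρ ≤ singleMeasuredDistance χ M ρ' +
      (ENNReal.ofReal (gFun ε) + ENNReal.ofReal ε * maximumVariation χ 𝓜) := by
  rcases le_or_gt ε 0 with hε0 | hε0
  · rw [eq_of_traceNorm_sub_le_zero hρ hρ' (hε.trans hε0)]
    exact le_self_add
  -- From here $\varepsilon>0$, so an infinite variation makes the bound trivial; otherwise every
  -- $Z_M$ is finite.
  rcases eq_or_ne (maximumVariation χ 𝓜) ⊤ with hκ | hκ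
  · rw [hκ, ENNReal.mul_top (by simpa using hε0)]
    simp
  obtain ⟨μ, ν, hμ, hν, hmix⟩ := exists_states_add_smul_eq hρ hρ' hε0 hε
  have hfin : ∀ {τ : Matrix d d ℂ}, IsQuantumState τ → singleMeasuredDistance χ M τ ≠ ⊤ :=
    fun hτ => ne_top_of_le_ne_top hκ (singleMeasuredDistance_le_maximumVariation hχ hne hM hτ)
  have h1ε : 0 < 1 + ε := by linarith
  set a := (1 + ε)⁻¹ with ha_def
  have ha : 0 < a := inv_pos.2 h1ε
  have hb : 0 < ε * a := mul_pos hε0 ha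
  have hab : a + ε * a = 1 := by rw [ha_def]; field_simp
  have hω : a • ρ + (ε * a) • μ = a • ρ' + (ε * a) • ν := by
    rw [mul_comm ε, mul_smul, mul_smul, ← smul_add, ← smul_add, hmix]
  have hconc := singleMeasuredDistance_almost_concave hχ M hρ hμ ha hb hab
  have hconv := singleMeasuredDistance_convex hχ hconvex M hρ' hν ha hb hab
  rw [← hω] at hconv
  have hνμ : singleMeasuredDistance χ M ν ≤ singleMeasuredDistance χ M μ + maximumVariation χ 𝓜 :=
    (le_add_absDifference _ _).trans (by gcongr; exact absDifference_le_maximumVariation hM hν hμ)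
  set κ := maximumVariation χ 𝓜
  have hkey : ENNReal.ofReal a * singleMeasuredDistance χ M ρ ≤ ENNReal.ofReal a *
      (singleMeasuredDistance χ M ρ' + (ENNReal.ofReal (gFun ε) + ENNReal.ofReal ε * κ)) := by
    have hg : ENNReal.ofReal (-(a * Real.log a) + -(ε * a * Real.log (ε * a))) =
        ENNReal.ofReal a * ENNReal.ofReal (gFun ε) := by
      rw [← ENNReal.ofReal_mul ha.le, gFun_eq_mul_entropy hε0, ← mul_assoc,
        inv_mul_cancel₀ h1ε.ne', one_mul]
    have hbμ : ENNReal.ofReal (ε * a) * singleMeasuredDistance χ M μ ≠ ⊤ :=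
      ENNReal.mul_ne_top ENNReal.ofReal_ne_top (hfin hμ)
    -- Cancelling the term in `μ` is legitimate only because it is finite.
    refine (ENNReal.add_le_add_iff_right hbμ).1 ?_
    calc _ ≤ _ := hconc
      _ ≤ ENNReal.ofReal a * singleMeasuredDistance χ M ρ' + ENNReal.ofReal (ε * a) *
          (singleMeasuredDistance χ M μ + κ) + ENNReal.ofReal a * ENNReal.ofReal (gFun ε) := by
        rw [← hg]
        refine add_le_add_left (hconv.trans ?_) _
        gcongr
      _ = _ := by
        rw [ENNReal.ofReal_mul hε0.le]
        ring
  exact (ENNReal.mul_le_mul_iff_right (by simpa using ha) ENNReal.ofReal_ne_top).1 hkey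

end

theorem mainTheorem3 {d : Type v} [Fintype d] [DecidableEq d]
    (χ : Set (Matrix d d ℂ)) (hχ : ∀ σ ∈ χ, IsQuantumState σ) (hne : χ.Nonempty)
    (hcompact : IsCompact χ) (hconvex : Convex ℝ χ)
    (𝓜 : Set (Measurement.{u, v} d)) (h𝓜 : MeasurementsConvex 𝓜)
    (h𝓜' : ClosedUnderDisjointMix 𝓜)
    (ρ ρ' : Matrix d d ℂ) (hρ : IsQuantumState ρ) (hρ' : IsQuantumState ρ')
    (ε : ℝ) (hε : 1 / 2 * traceNorm (ρ - ρ') ≤ ε) :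
    (maximumVariation χ 𝓜 ≠ ⊤ → measuredDistance χ 𝓜 ρ ≠ ⊤ ∧ measuredDistance χ 𝓜 ρ' ≠ ⊤) ∧
    absDifference (measuredDistance χ 𝓜 ρ) (measuredDistance χ 𝓜 ρ') ≤
      ENNReal.ofReal (gFun ε) + ENNReal.ofReal ε * maximumVariation χ 𝓜 := by
  have hminimax : ∀ {τ : Matrix d d ℂ}, IsQuantumState τ →
      measuredDistance χ 𝓜 τ = ⨆ M ∈ 𝓜, singleMeasuredDistance χ M τ := fun hτ =>
    measuredDistance_eq_iSup hχ hne hcompact hconvex h𝓜' hτ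
  have hbound : ∀ {τ τ' : Matrix d d ℂ}, IsQuantumState τ → IsQuantumState τ' →
      1 / 2 * traceNorm (τ - τ') ≤ ε → measuredDistance χ 𝓜 τ ≤ measuredDistance χ 𝓜 τ' +
        (ENNReal.ofReal (gFun ε) + ENNReal.ofReal ε * maximumVariation χ 𝓜) := by
    intro τ τ' hτ hτ' h
    rw [hminimax hτ, hminimax hτ']
    refine iSup₂_le fun M hM => (singleMeasuredDistance_le_add hχ hne hconvex hM hτ hτ' h).trans ?_
    gcongr
    exact le_iSup₂ (f := fun M (_ : M ∈ 𝓜) => singleMeasuredDistance χ M τ') M hM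
  have hfin : ∀ {τ : Matrix d d ℂ}, IsQuantumState τ →
      measuredDistance χ 𝓜 τ ≤ maximumVariation χ 𝓜 := fun hτ => by
    rw [hminimax hτ]
    exact iSup₂_le fun M hM => singleMeasuredDistance_le_maximumVariation hχ hne hM hτ
  have hε' : 1 / 2 * traceNorm (ρ' - ρ) ≤ ε := by
    rwa [traceNorm, ← neg_sub ρ ρ', Matrix.conjTranspose_neg, neg_mul_neg, ← traceNorm]
  exact ⟨fun hκ => ⟨ne_top_of_le_ne_top hκ (hfin hρ), ne_top_of_le_ne_top hκ (hfin hρ')⟩,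
    absDifference_le (hbound hρ hρ' hε) (hbound hρ' hρ hε')⟩
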